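/- **Proposition 4.1.** Let $\mathcal B\subseteq B(G)$ be a von Neumann algebra on a complex Hilbert space $G$ and let $\varphi:\mathcal B\to\mathcal B$ be a completely positive map (not assumed normal). A *von Neumann $\mathcal B$-module* is a right Hilbert $\mathcal B$-module $E$ (with inner product $\langle\cdot,\cdot\rangle$ linear in the second variable) which, when $x\in E$ is identified with the operator $L_x:g\mapsto x\odot g$, is strongly closed in $B(G,E\odot G)$; here $E\odot G$ is the Hilbert space obtained from $E\otimes G$ with the semi-inner product $\langle x\otimes g,x'\otimes g'\rangle=\langle g,\langle x,x'\rangle g'\rangle$. A *von Neumann $\mathcal B$-$\mathcal B$-module* is a von Neumann $\mathcal B$-module with a unital $*$-representation of $\mathcal B$ by adjointable operators on it, written as a left action. Let $(E,x)$ be the minimal GNS-construction for $\varphi$, i.e. $E$ is a von Neumann $\mathcal B$-$\mathcal B$-module and $x\in E$ is such that $\varphi(b)=\langle x,bx\rangle$ for all $b\in\mathcal B$ and the strong closure of $\operatorname{span}\,\mathcal B x\mathcal B$ is $E$. Then the following are equivalent: (i) The center $C_{\mathcal B}(E):=\{y\in E: by=yb\ \ \forall b\in\mathcal B\}$ contains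 a unit vector, i.e. some $z$ with $\langle z,z\rangle=1_{\mathcal B}$. (ii) $E\cong\mathcal B\oplus F$ (by a bijective, inner-product preserving, bilinear map) for some von Neumann $\mathcal B$-$\mathcal B$-module $F$ (possibly $F=\{0\}$), where $\mathcal B$ carries the inner product $\langle a,b\rangle=a^*b$. (iii) There exist an element $c\in\mathcal B$ such that the strongly closed two-sided ideal of $\mathcal B$ generated by $c$ is $\mathcal B$, and a completely positive map $\psi:\mathcal B\to\mathcal B$, such that $$\varphi(b)=c^*bc+\psi(b)\qquad\forall b\in\mathcal B.$$ -/

import Mathlib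

open scoped TensorProduct RightActions InnerProductSpace CStarAlgebra WithCStarModule

universe u v

noncomputable section

set_option linter.unusedSectionVars false

/-! ### A von Neumann algebra `B ⊆ B(G)` as an ordered C⋆-algebra -/

namespace VonNeumannAlgebra

variable {G : Type*} [NormedAddCommGroup G] [InnerProductSpace ℂ G] [CompleteSpace G]

instance instSMulMemClass : SMulMemClass (VonNeumannAlgebra G) ℂ (G →L[ℂ] G) where
  smul_mem {s} c _ hx := s.toStarSubalgebra.smul_mem hx c

instance instIsClosed (B : VonNeumannAlgebra G) : IsClosed (B : Set (G →L[ℂ] G)) := by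
  rw [← B.centralizer_centralizer]
  exact Set.isClosed_centralizer _

/-- The operator order which `B` inherits from `B(G)` is the order of the C⋆-algebra `B`. -/
instance instStarOrderedRing (B : VonNeumannAlgebra G) : StarOrderedRing B := by
  refine StarOrderedRing.of_nonneg_iff' (fun {x y} h z => ?_) (fun x => ⟨fun hx => ?_, ?_⟩)
  · exact add_le_add_right (α := G →L[ℂ] G) h z
  · have hx' : (0 : G →L[ℂ] G) ≤ (x : G →L[ℂ] G) := hx
    have hsa : IsSelfAdjoint x := Subtype.ext (IsSelfAdjoint.of_nonneg hx')
    have hsp : SpectrumRestricts x ContinuousMap.realToNNReal := by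
      have h := SpectrumRestricts.nnreal_of_nonneg hx'
      rw [SpectrumRestricts.nnreal_iff] at h ⊢
      intro r hr
      apply h
      have hc : spectrum ℂ x = spectrum ℂ (x : G →L[ℂ] G) :=
        StarSubalgebra.spectrum_eq (S := B.toStarSubalgebra) (hS := instIsClosed B)
      rw [← spectrum.preimage_algebraMap ℂ] at hr ⊢
      simpa only [Set.mem_preimage, hc] using hr
    obtain ⟨s, hs, -, h⟩ := CFC.exists_sqrt_of_isSelfAdjoint_of_quasispectrumRestricts hsa
      ((quasispectrumRestricts_iff_spectrumRestricts).2 hsp)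
    exact ⟨s, by rw [hs.star_eq, h]⟩
  · rintro ⟨s, rfl⟩
    exact star_mul_self_nonneg (s : G →L[ℂ] G)

end VonNeumannAlgebra

/-- The closure of a set of bounded operators in the strong operator topology. -/
def sotClosure {H K : Type*} [NormedAddCommGroup H] [InnerProductSpace ℂ H]
    [NormedAddCommGroup K] [InnerProductSpace ℂ K] (S : Set (H →L[ℂ] K)) : Set (H →L[ℂ] K) :=
  ContinuousLinearMap.toPointwiseConvergenceCLM ℂ (RingHom.id ℂ) H K ⁻¹'
    closure (ContinuousLinearMap.toPointwiseConvergenceCLM ℂ (RingHom.id ℂ) H K '' S)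

/-! ### Hilbert modules

A right Hilbert `A`-module `E` is expressed by `[Module Aᵐᵒᵖ E] [CStarModule Aᵐᵒᵖ E]`, the right
action being `x <• a = MulOpposite.op a • x`. Its `A`-valued inner product is `ip A x y`, linear in
the second variable, with `ip A x (y <• a) = ip A x y * a`. -/

section HilbertModule

variable (A : Type*) [CStarAlgebra A] [PartialOrder A] [StarOrderedRing A]

/-- The `A`-valued inner product of a right Hilbert `A`-module. -/
def ip {E : Type*} [NormedAddCommGroup E] [NormedSpace ℂ E] [Module Aᵐᵒᵖ E] [CStarModule Aᵐᵒᵖ E]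
    (x y : E) : A :=
  MulOpposite.unop (inner Aᵐᵒᵖ x y)

/-- `A` as a right Hilbert module over itself, with inner product `⟨a, b⟩ = a⋆ b`. -/
instance instCStarModuleMulOppositeSelf : CStarModule Aᵐᵒᵖ A where
  inner x y := MulOpposite.op (star x * y)
  inner_add_right := by simp [mul_add]
  inner_self_nonneg {x} := star_mul_self_nonneg x
  inner_self {x} := by simp
  inner_op_smul_right := by
    intro a x y
    simp [mul_assoc]
  inner_smul_right_complex := by simp
  star_inner x y := by simp [← MulOpposite.op_star]
  norm_eq_sqrt_norm_inner_self x := by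
    rw [MulOpposite.norm_op, CStarRing.norm_star_mul_self, Real.sqrt_mul_self (norm_nonneg x)]

variable {A} {E : Type*} [NormedAddCommGroup E] [NormedSpace ℂ E] [Module Aᵐᵒᵖ E]
  [CStarModule Aᵐᵒᵖ E]

theorem ip_add_right (x y z : E) : ip A x (y + z) = ip A x y + ip A x z := by simp [ip]
theorem ip_add_left (x y z : E) : ip A (x + y) z = ip A x z + ip A y z := by simp [ip]
theorem ip_smul_right (c : ℂ) (x y : E) : ip A x (c • y) = c • ip A x y := by simp [ip]
theorem ip_smul_left (c : ℂ) (x y : E) : ip A (c • x) y = star c • ip A x y := by simp [ip]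
theorem star_ip (x y : E) : star (ip A x y) = ip A y x := by
  rw [ip, ip, ← MulOpposite.unop_star, CStarModule.star_inner]
theorem ip_self_nonneg (x : E) : 0 ≤ ip A x x := CStarModule.inner_self_nonneg (A := Aᵐᵒᵖ) (x := x)
theorem ip_op_smul_right (a : A) (x y : E) : ip A x (y <• a) = ip A x y * a := by simp [ip]
theorem ip_op_smul_left (a : A) (x y : E) : ip A (x <• a) y = star a * ip A x y := by simp [ip]
theorem ip_sum_right {ι : Type*} (s : Finset ι) (x : E) (y : ι → E) :
    ip A x (∑ i ∈ s, y i) = ∑ i ∈ s, ip A x (y i) := by simp [ip]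
theorem ip_sum_left {ι : Type*} (s : Finset ι) (x : ι → E) (y : E) :
    ip A (∑ i ∈ s, x i) y = ∑ i ∈ s, ip A (x i) y := by simp [ip]
theorem norm_ip_self (x : E) : ‖ip A x x‖ = ‖x‖ ^ 2 := by
  rw [ip, MulOpposite.norm_unop, CStarModule.norm_sq_eq (A := Aᵐᵒᵖ)]

/-- Auxiliary to the positivity of Gram matrices: `N` is the negative part of `M`. -/
theorem exists_pos_part_data {R : Type*} [CStarAlgebra R] [PartialOrder R] [StarOrderedRing R]
    {M : R} (hM : IsSelfAdjoint M) :
    ∃ N T : R, star N * M * N = -(star (T * N) * (T * N)) ∧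
      (T * N = 0 → ∃ S, M = star S * S) := by
  have hN0 : 0 ≤ M⁻ := CFC.negPart_nonneg M
  have hNsa : star M⁻ = M⁻ := (IsSelfAdjoint.of_nonneg hN0).star_eq
  obtain ⟨T, hT⟩ := CStarAlgebra.nonneg_iff_eq_star_mul_self.1 hN0
  refine ⟨M⁻, T, ?_, fun hTN => ?_⟩
  · have h1 : M⁻ * M = - (M⁻ * M⁻) := by
      nth_rewrite 2 [← CFC.posPart_sub_negPart M hM]
      rw [mul_sub, CFC.negPart_mul_posPart, zero_sub]
    rw [hNsa, h1, star_mul, hNsa, mul_assoc, ← mul_assoc (star T), ← hT]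
    simp [mul_assoc]
  · have hN : M⁻ = 0 := by
      rw [← CStarRing.star_mul_self_eq_zero_iff, hNsa]
      nth_rewrite 1 [hT]
      rw [mul_assoc, hTN, mul_zero]
    exact CStarAlgebra.nonneg_iff_eq_star_mul_self.1 ((CFC.negPart_eq_zero_iff M hM).1 hN)

/-- Gram matrices in a Hilbert module are positive. -/
theorem exists_gram_eq {n : Type*} [Fintype n] (X : n → E) :
    ∃ S : n → n → A, ∀ i j, ip A (X i) (X j) = ∑ k, star (S k i) * S k j := by
  classical
  let M : CStarMatrix n n A := CStarMatrix.ofMatrix fun i j => ip A (X i) (X j)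
  have hM : ∀ i j, M i j = ip A (X i) (X j) := fun _ _ => rfl
  have hsa : IsSelfAdjoint M := by
    ext i j
    rw [CStarMatrix.star_apply, hM, hM, star_ip]
  obtain ⟨N, T, h3, h4⟩ := exists_pos_part_data hsa
  have hTN : T * N = 0 := by
    have key : ∀ k, ∑ i, star ((T * N) i k) * (T * N) i k ≤ 0 := by
      intro k
      have e1 : (star (T * N) * (T * N)) k k = ∑ i, star ((T * N) i k) * (T * N) i k := by
        rw [CStarMatrix.mul_apply]; rfl
      have e2 : (star N * M * N) k k = ip A (∑ i, X i <• N i k) (∑ j, X j <• N j k) := by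
        rw [CStarMatrix.mul_apply, ip_sum_right]
        refine Finset.sum_congr rfl fun j _ => ?_
        rw [ip_op_smul_right, ip_sum_left, CStarMatrix.mul_apply]
        congr 1
        refine Finset.sum_congr rfl fun i _ => ?_
        rw [ip_op_smul_left, CStarMatrix.star_apply, hM]
      have e3 := congrFun (congrFun h3 k) k
      rw [e2] at e3
      have e4 : 0 ≤ - (star (T * N) * (T * N)) k k := by
        rw [← CStarMatrix.neg_apply, ← e3]
        exact ip_self_nonneg _
      rw [e1] at e4
      exact neg_nonneg.1 e4
    ext i k
    have h0 := (Finset.sum_eq_zero_iff_of_nonneg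
      (fun i _ => star_mul_self_nonneg ((T * N) i k))).1
      (le_antisymm (key k) (Finset.sum_nonneg fun i _ => star_mul_self_nonneg _)) i
      (Finset.mem_univ i)
    exact (CStarRing.star_mul_self_eq_zero_iff _).1 h0
  obtain ⟨S, hS⟩ := h4 hTN
  refine ⟨fun i j => S i j, fun i j => ?_⟩
  rw [← hM, hS, CStarMatrix.mul_apply]
  rfl

end HilbertModule

/-! ### The Hilbert space `E ⊙ G` and the embedding `E ⊆ B(G, E ⊙ G)` -/

section InteriorTensor

variable {G : Type*} [NormedAddCommGroup G] [InnerProductSpace ℂ G] [CompleteSpace G]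
  (B : VonNeumannAlgebra G)
  (E : Type*) [NormedAddCommGroup E] [NormedSpace ℂ E] [Module Bᵐᵒᵖ E] [CStarModule Bᵐᵒᵖ E]

/-- The algebraic tensor product `E ⊗ G`, to be equipped with the semi-inner product
`⟨x ⊗ g, x' ⊗ g'⟩ = ⟨g, ⟨x, x'⟩ g'⟩`. -/
@[nolint unusedArguments]
def AlgTensor (_B : VonNeumannAlgebra G) (E : Type*) [NormedAddCommGroup E] [NormedSpace ℂ E] :
    Type _ := E ⊗[ℂ] G

namespace AlgTensor

instance : AddCommGroup (AlgTensor B E) := inferInstanceAs (AddCommGroup (E ⊗[ℂ] G))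
instance : Module ℂ (AlgTensor B E) := inferInstanceAs (Module ℂ (E ⊗[ℂ] G))

/-- The sesquilinear form on `E ⊗ G` with `⟨x ⊗ g, x' ⊗ g'⟩ = ⟨g, ⟨x, x'⟩ g'⟩`. -/
def form : (E ⊗[ℂ] G) →ₗ⋆[ℂ] (E ⊗[ℂ] G) →ₗ[ℂ] ℂ :=
  TensorProduct.lift (LinearMap.mk₂'ₛₗ (starRingEnd ℂ) (starRingEnd ℂ)
    (fun (x : E) (g : G) => TensorProduct.lift (LinearMap.mk₂ ℂ
      (fun (x' : E) (g' : G) => ⟪g, (ip B x x' : G →L[ℂ] G) g'⟫_ℂ)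
      (fun x₁ x₂ g' => by simp [ip_add_right])
      (fun c x' g' => by simp [ip_smul_right])
      (fun x' g₁ g₂ => by simp)
      (fun c x' g' => by simp)))
    (fun x₁ x₂ g => TensorProduct.ext' fun x' g' => by simp [ip_add_left])
    (fun c x g => TensorProduct.ext' fun x' g' => by simp [ip_smul_left])
    (fun x g₁ g₂ => TensorProduct.ext' fun x' g' => by simp)
    (fun c x g => TensorProduct.ext' fun x' g' => by simp [mul_comm]))

theorem form_tmul (x x' : E) (g g' : G) :
    form B E (x ⊗ₜ g) (x' ⊗ₜ g') = ⟪g, (ip B x x' : G →L[ℂ] G) g'⟫_ℂ := rfl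

theorem form_symm (s t : E ⊗[ℂ] G) : starRingEnd ℂ (form B E t s) = form B E s t := by
  induction s with
  | zero => simp
  | add s₁ s₂ h₁ h₂ => simp [h₁, h₂]
  | tmul x g =>
    induction t with
    | zero => simp
    | add t₁ t₂ h₁ h₂ => simp only [map_add, LinearMap.add_apply, h₁, h₂]
    | tmul x' g' =>
      rw [form_tmul, form_tmul, inner_conj_symm, ← star_ip x' x, StarMemClass.coe_star,
        ContinuousLinearMap.star_eq_adjoint, ContinuousLinearMap.adjoint_inner_right]

theorem inner_star_mul (T U : G →L[ℂ] G) (g h : G) :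
    ⟪g, (star T * U : G →L[ℂ] G) h⟫_ℂ = ⟪T g, U h⟫_ℂ :=
  ContinuousLinearMap.adjoint_inner_right T g (U h)

theorem form_nonneg (t : E ⊗[ℂ] G) : 0 ≤ (form B E t t).re := by
  obtain ⟨s, rfl⟩ := TensorProduct.exists_finset t
  obtain ⟨S, hS⟩ := exists_gram_eq (A := B) (fun i : s => i.1.1)
  have h : form B E (∑ i ∈ s, i.1 ⊗ₜ i.2) (∑ i ∈ s, i.1 ⊗ₜ i.2)
      = ∑ k, ⟪∑ i : s, (S k i : G →L[ℂ] G) i.1.2, ∑ j : s, (S k j : G →L[ℂ] G) j.1.2⟫_ℂ := by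
    have hk : ∀ (i j : s) (k : s), ⟪i.1.2, ((star (S k i) * S k j : B) : G →L[ℂ] G) j.1.2⟫_ℂ
        = ⟪(S k i : G →L[ℂ] G) i.1.2, (S k j : G →L[ℂ] G) j.1.2⟫_ℂ := fun i j k => by
      rw [MulMemClass.coe_mul, StarMemClass.coe_star, inner_star_mul]
    have hij : ∀ i j : s, form B E (i.1.1 ⊗ₜ i.1.2) (j.1.1 ⊗ₜ j.1.2)
        = ∑ k, ⟪(S k i : G →L[ℂ] G) i.1.2, (S k j : G →L[ℂ] G) j.1.2⟫_ℂ := fun i j => by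
      rw [form_tmul, hS, AddSubmonoidClass.coe_finsetSum, sum_apply,
        inner_sum]
      exact Finset.sum_congr rfl fun k _ => hk i j k
    rw [← Finset.sum_coe_sort s]
    simp only [map_sum, LinearMap.sum_apply, hij, sum_inner, inner_sum]
    rw [Finset.sum_congr rfl fun j _ => Finset.sum_comm, Finset.sum_comm]
  rw [h, Complex.re_sum]
  exact Finset.sum_nonneg fun k _ => inner_self_nonneg (𝕜 := ℂ)

instance instCore : PreInnerProductSpace.Core ℂ (AlgTensor B E) where
  inner s t := form B E s t
  conj_inner_symm s t := form_symm B E s t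
  re_inner_nonneg t := form_nonneg B E t
  add_left _ _ _ := LinearMap.map_add₂ _ _ _ _
  smul_left _ _ _ := LinearMap.map_smulₛₗ₂ _ _ _ _

instance : SeminormedAddCommGroup (AlgTensor B E) :=
  InnerProductSpace.Core.toSeminormedAddCommGroup (𝕜 := ℂ)
instance : InnerProductSpace ℂ (AlgTensor B E) := InnerProductSpace.ofCore (instCore B E)

variable {E} in
/-- `g ↦ x ⊗ g`. -/
def tmul (x : E) : G →ₗ[ℂ] AlgTensor B E := TensorProduct.mk ℂ E G x

theorem inner_tmul (x x' : E) (g g' : G) :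
    ⟪tmul B x g, tmul B x' g'⟫_ℂ = ⟪g, (ip B x x' : G →L[ℂ] G) g'⟫_ℂ := rfl

theorem norm_tmul_le (x : E) (g : G) : ‖tmul B x g‖ ≤ ‖x‖ * ‖g‖ := by
  refine (sq_le_sq₀ (norm_nonneg _) (by positivity)).1 ?_
  rw [← inner_self_eq_norm_sq (𝕜 := ℂ), inner_tmul]
  calc _ ≤ ‖⟪g, (ip B x x : G →L[ℂ] G) g⟫_ℂ‖ := RCLike.re_le_norm _
    _ ≤ ‖g‖ * (‖(ip B x x : G →L[ℂ] G)‖ * ‖g‖) := (norm_inner_le_norm _ _).trans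
        (mul_le_mul_of_nonneg_left (ContinuousLinearMap.le_opNorm _ _) (norm_nonneg _))
    _ = ‖g‖ * (‖x‖ ^ 2 * ‖g‖) := by
        rw [← norm_ip_self (A := B) x]; rfl
    _ = (‖x‖ * ‖g‖) ^ 2 := by ring

end AlgTensor

/-- The Hilbert space `E ⊙ G`: the completion of `E ⊗ G` modulo the null space of its semi-inner
product. (`UniformSpace.Completion` is the Hausdorff completion.) -/
abbrev InteriorTensor : Type _ := UniformSpace.Completion (AlgTensor B E)

variable {E}

/-- The operator `L_x : G → E ⊙ G`, `g ↦ x ⊙ g`. -/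
def creation (x : E) : G →L[ℂ] InteriorTensor B E :=
  (UniformSpace.Completion.toComplL (𝕜 := ℂ) (E := AlgTensor B E)).comp
    ((AlgTensor.tmul B x).mkContinuous ‖x‖ (AlgTensor.norm_tmul_le B E x))

theorem creation_apply (x : E) (g : G) : creation B x g = (AlgTensor.tmul B x g : AlgTensor B E) :=
  rfl

theorem inner_creation (x x' : E) (g g' : G) :
    ⟪creation B x g, creation B x' g'⟫_ℂ = ⟪g, (ip B x x' : G →L[ℂ] G) g'⟫_ℂ := by
  rw [creation_apply, creation_apply, UniformSpace.Completion.inner_coe, AlgTensor.inner_tmul]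

end InteriorTensor

/-! ### Von Neumann modules, bimodules and the minimal GNS-construction -/

section VonNeumannModule

variable {G : Type*} [NormedAddCommGroup G] [InnerProductSpace ℂ G] [CompleteSpace G]

/-- A (right) von Neumann `B`-module: a Hilbert `B`-module `E` which, identified with the space of
operators `L_x`, `x ∈ E`, is strongly closed in `B(G, E ⊙ G)`. -/
class IsVonNeumannModule (B : VonNeumannAlgebra G) (E : Type*) [NormedAddCommGroup E]
    [NormedSpace ℂ E] [Module Bᵐᵒᵖ E] [CStarModule Bᵐᵒᵖ E] : Prop where
  complete : CompleteSpace E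
  sot_closed : sotClosure (Set.range (creation B (E := E))) = Set.range (creation B (E := E))

/-- A von Neumann `A`-`B`-module: a von Neumann `B`-module `E` with a unital `⋆`-representation of
`A` by adjointable operators on `E`, written as a left action of `A`. (Adjointable operators are
automatically bounded and `B`-linear.) -/
class IsVonNeumannBimodule (A : Type*) [CStarAlgebra A] (B : VonNeumannAlgebra G) (E : Type*)
    [NormedAddCommGroup E] [NormedSpace ℂ E] [Module A E] [Module Bᵐᵒᵖ E] [CStarModule Bᵐᵒᵖ E] :
    Prop extends IsVonNeumannModule B E, IsScalarTower ℂ A E, SMulCommClass A Bᵐᵒᵖ E where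
  ip_left_action : ∀ (a : A) (x y : E), ip B (a • x) y = ip B x (star a • y)

/-- The `B`-center `{y ∈ E : b y = y b for all b ∈ B}` of a `B`-`B`-module `E`. -/
def bimoduleCenter (B : VonNeumannAlgebra G) (E : Type*) [AddCommGroup E] [Module B E]
    [Module Bᵐᵒᵖ E] : Set E :=
  {y | ∀ b : B, b • y = y <• b}

/-- An isomorphism of `A`-`B`-modules: a bilinear bijection which preserves the inner product. -/
structure BimoduleIso (A : Type*) [CStarAlgebra A] (B : VonNeumannAlgebra G) (E F : Type*)
    [NormedAddCommGroup E] [NormedSpace ℂ E] [Module A E] [Module Bᵐᵒᵖ E] [CStarModule Bᵐᵒᵖ E]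
    [NormedAddCommGroup F] [NormedSpace ℂ F] [Module A F] [Module Bᵐᵒᵖ F] [CStarModule Bᵐᵒᵖ F]
    extends E ≃ₗ[ℂ] F where
  map_left : ∀ (a : A) (x : E), toFun (a • x) = a • toFun x
  map_right : ∀ (b : B) (x : E), toFun (x <• b) = toFun x <• b
  map_ip : ∀ x y : E, ip B (toFun x) (toFun y) = ip B x y

/-- `(E, x)` is a minimal GNS-construction for `φ`: `φ(a) = ⟨x, a x⟩`, and `E` is the strong closure
of the linear span of `{a x b}`. -/
structure IsMinimalGNS {A : Type*} [CStarAlgebra A] {B : VonNeumannAlgebra G} {E : Type*}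
    [NormedAddCommGroup E] [NormedSpace ℂ E] [Module A E] [Module Bᵐᵒᵖ E] [CStarModule Bᵐᵒᵖ E]
    (φ : A → B) (x : E) : Prop where
  gns : ∀ a : A, φ a = ip B x (a • x)
  minimal : ∀ y : E, creation B y ∈
    sotClosure (creation B '' (Submodule.span ℂ {z : E | ∃ (a : A) (b : B), z = (a • x) <• b}))

/-- The strong closure of the two-sided ideal of `B` generated by `c`. -/
def stronglyClosedIdeal {B : VonNeumannAlgebra G} (c : B) : Set (G →L[ℂ] G) :=
  sotClosure ((fun b : B => (b : G →L[ℂ] G)) '' (TwoSidedIdeal.span {c} : Set B))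

end VonNeumannModule

end

set_option linter.unusedSectionVars false

open Filter Topology

/-! ### Strong operator closure in terms of filters. -/

section StrongClosure

variable {H K : Type*} [NormedAddCommGroup H] [InnerProductSpace ℂ H]
    [NormedAddCommGroup K] [InnerProductSpace ℂ K]

/-! Let `z` be a central unit vector. The map `y ↦ z⟨z,y⟩` is then a bilinear projection onto a copy
of `B`, and its complement `{y | ⟨z,y⟩ = 0}` is a strongly closed sub-bimodule, so `E` splits as `B
⊕ F`. Conversely, the vector matching `(1, 0)` in such a splitting is a central unit vector.

Put `c = ⟨z,x⟩`. Applying the splitting to `x` itself gives `φ(b) = c⋆bc + ⟨f, bf⟩` with `f = x -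
zc`, and the last term is completely positive. The ideal of `c` is strongly dense because `⟨z, axb⟩
= acb`: each `T ∈ B` equals `T⟨z,z⟩`, and the second `z` is a strong limit of elements of `span
BxB`.

The substantial direction starts from `φ = c⋆·c + ψ`. Complete positivity of `ψ` makes `ax ⊙ g ↦
acg` a contraction `V : E ⊙ G → G`. Minimality gives `V L_y ∈ B` for every `y`, so self-duality of
von Neumann modules (`mem_range_creation_of_adjoint_comp_mem`) yields `V⋆ = L_ζ` for some `ζ ∈ E`.
From `⟨ax, ζ⟩ = (ac)⋆` it follows that `ζ` is central. If `L_ζ h = 0`, then `h` is orthogonal to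
`acG` for all `a`, hence to `JG` for the strongly closed ideal `J` generated by `c`; since `J = B`,
this forces `h = 0`. So `L_ζ` is injective, and the polar part of `ζ`, again in `E` by self-duality,
is a central unit vector. -/

theorem mem_sotClosure_iff_tendsto {S : Set (H →L[ℂ] K)} {T : H →L[ℂ] K} :
    T ∈ sotClosure S ↔ ∃ l : Filter (H →L[ℂ] K), l.NeBot ∧ S ∈ l ∧
      ∀ g, Tendsto (fun s : H →L[ℂ] K => s g) l (𝓝 (T g)) := by
  set e := ContinuousLinearMap.toPointwiseConvergenceCLM ℂ (RingHom.id ℂ) H K with he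
  constructor
  · intro h
    have h1 : (𝓝 (e T) ⊓ 𝓟 (e '' S)).NeBot := mem_closure_iff_clusterPt.1 h
    rw [← map_principal, inf_comm, ← Filter.push_pull, map_neBot_iff] at h1
    refine ⟨𝓟 S ⊓ comap e (𝓝 (e T)), h1, mem_inf_of_left (mem_principal_self S), fun g => ?_⟩
    have h2 : Tendsto e (𝓟 S ⊓ comap e (𝓝 (e T))) (𝓝 (e T)) :=
      tendsto_comap.mono_left inf_le_right
    exact PointwiseConvergenceCLM.tendsto_iff_forall_tendsto.1 h2 g
  · rintro ⟨l, hl, hS, h⟩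
    have h' : Tendsto (fun s => e s) l (𝓝 (e T)) :=
      PointwiseConvergenceCLM.tendsto_iff_forall_tendsto.2 h
    change e T ∈ closure (e '' S)
    refine mem_closure_of_tendsto h' ?_
    filter_upwards [hS] with s hs using ⟨s, hs, rfl⟩

theorem mem_sotClosure_of_forall_finset {S : Set (H →L[ℂ] K)} {T : H →L[ℂ] K}
    (h : ∀ (t : Finset H) (ε : ℝ), 0 < ε → ∃ s ∈ S, ∀ g ∈ t, ‖s g - T g‖ < ε) :
    T ∈ sotClosure S := by
  set e := ContinuousLinearMap.toPointwiseConvergenceCLM ℂ (RingHom.id ℂ) H K with he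
  change e T ∈ closure (e '' S)
  refine mem_closure_iff_nhds.2 fun U hU => ?_
  have hU' : (fun v => e T + v) ⁻¹' U ∈ 𝓝 (0 : H →Lₚₜ[ℂ] K) := by
    have hc : Continuous fun v : H →Lₚₜ[ℂ] K => e T + v := continuous_const.add continuous_id
    refine hc.continuousAt.preimage_mem_nhds ?_
    rwa [add_zero]
  obtain ⟨⟨t, ε⟩, ⟨ht, hε⟩, hsub⟩ :=
    (PointwiseConvergenceCLM.hasBasis_nhds_zero_of_basis Metric.nhds_basis_ball).mem_iff.1 hU'
  have ht' : t.Finite := ht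
  obtain ⟨s, hs, hst⟩ := h ht'.toFinset ε hε
  refine ⟨e s, ?_, ⟨s, hs, rfl⟩⟩
  have h1 : e s - e T ∈ (fun v => e T + v) ⁻¹' U := hsub fun g hg => by
    rw [mem_ball_zero_iff]
    exact hst g (ht'.mem_toFinset.2 hg)
  rwa [Set.mem_preimage, add_sub_cancel] at h1

theorem subset_sotClosure (S : Set (H →L[ℂ] K)) : S ⊆ sotClosure S := fun s hs =>
  mem_sotClosure_of_forall_finset fun _ ε hε => ⟨s, hs, fun _ _ => by simpa using hε⟩

/-- A strongly closed condition passes to the strong closure. -/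
theorem sotClosure_induction {S : Set (H →L[ℂ] K)} {T : H →L[ℂ] K} (hT : T ∈ sotClosure S)
    {X : Type*} [TopologicalSpace X] [T2Space X] {f f' : (H →L[ℂ] K) → X}
    (hf : ∀ l : Filter (H →L[ℂ] K), (∀ g, Tendsto (fun s : H →L[ℂ] K => s g) l (𝓝 (T g))) →
      Tendsto f l (𝓝 (f T)))
    (hf' : ∀ l : Filter (H →L[ℂ] K), (∀ g, Tendsto (fun s : H →L[ℂ] K => s g) l (𝓝 (T g))) →
      Tendsto f' l (𝓝 (f' T)))
    (h : ∀ s ∈ S, f s = f' s) : f T = f' T := by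
  obtain ⟨l, hl, hS, hlim⟩ := mem_sotClosure_iff_tendsto.1 hT
  refine tendsto_nhds_unique (hf l hlim) ((hf' l hlim).congr' ?_)
  filter_upwards [hS] with s hs using (h s hs).symm

/-- Multiplication by fixed bounded operators on both sides is strongly continuous. This is the tool
for carrying strong limits between `G`, `E ⊙ G` and `F ⊙ G`. -/
theorem sotClosure_mapsTo {H' K' : Type*} [NormedAddCommGroup H'] [InnerProductSpace ℂ H']
    [NormedAddCommGroup K'] [InnerProductSpace ℂ K'] {S : Set (H →L[ℂ] K)}
    {S' : Set (H' →L[ℂ] K')} {T : H →L[ℂ] K} (hT : T ∈ sotClosure S) (A : K →L[ℂ] K')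
    (C : H' →L[ℂ] H) (h : ∀ s ∈ S, A ∘L s ∘L C ∈ S') : A ∘L T ∘L C ∈ sotClosure S' := by
  obtain ⟨l, hl, hS, hlim⟩ := mem_sotClosure_iff_tendsto.1 hT
  refine mem_sotClosure_iff_tendsto.2 ⟨l.map (fun s => A ∘L s ∘L C), hl.map _, ?_, fun g => ?_⟩
  · exact mem_map.2 (mem_of_superset hS h)
  · exact tendsto_map'_iff.2 ((A.continuous.tendsto _).comp (hlim (C g)))

end StrongClosure

/-! ### Membership in `B` through the commutant. -/

namespace VonNeumannAlgebra

variable {G : Type*} [NormedAddCommGroup G] [InnerProductSpace ℂ G] [CompleteSpace G]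
  (B : VonNeumannAlgebra G)

theorem mem_iff_forall_commutant {T : G →L[ℂ] G} :
    T ∈ B ↔ ∀ S ∈ B.commutant, ∀ g, S (T g) = T (S g) := by
  conv_lhs => rw [← commutant_commutant B, mem_commutant_iff]
  exact forall₂_congr fun S _ => ContinuousLinearMap.ext_iff

theorem commutant_apply_comm {S T : G →L[ℂ] G} (hS : S ∈ B.commutant) (hT : T ∈ B) (g : G) :
    S (T g) = T (S g) := (B.mem_iff_forall_commutant.1 hT) S hS g

/-- Commuting with a fixed bounded operator survives strong limits, and `B` is its own bicommutant.
-/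
theorem sotClosure_subset {S : Set (G →L[ℂ] G)} (hS : S ⊆ B) : sotClosure S ⊆ B := by
  intro T hT
  refine B.mem_iff_forall_commutant.2 fun R hR g => ?_
  exact sotClosure_induction hT (f := fun T => R (T g)) (f' := fun T => T (R g))
    (fun l h => (R.continuous.tendsto _).comp (h g)) (fun l h => h (R g))
    fun s hs => B.commutant_apply_comm hR (hS hs) g

end VonNeumannAlgebra

/-! ### Nondegeneracy of the module inner product. -/

section HilbertModule

variable {A : Type*} [CStarAlgebra A] [PartialOrder A] [StarOrderedRing A]
variable {E : Type*} [NormedAddCommGroup E] [NormedSpace ℂ E] [Module Aᵐᵒᵖ E]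
  [CStarModule Aᵐᵒᵖ E]

theorem ip_sub_right (x y z : E) : ip A x (y - z) = ip A x y - ip A x z := by simp [ip]
theorem ip_sub_left (x y z : E) : ip A (x - y) z = ip A x z - ip A y z := by simp [ip]
theorem ip_zero_right (x : E) : ip A x 0 = 0 := by simp [ip]

theorem ip_self_eq_zero {x : E} : ip A x x = 0 ↔ x = 0 := by
  rw [← norm_eq_zero, norm_ip_self]; simp

theorem ext_ip {x y : E} (h : ∀ w, ip A w x = ip A w y) : x = y := by
  rw [← sub_eq_zero, ← ip_self_eq_zero (A := A), ip_sub_right, h, sub_self]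

theorem smul_op_smul (c : ℂ) (a : A) (x : E) : c • (x <• a) = x <• (c • a) :=
  ext_ip (A := A) fun w => by rw [ip_smul_right, ip_op_smul_right, ip_op_smul_right, mul_smul_comm]

end HilbertModule

/-! ### The operators `L_x` and self-duality of von Neumann modules. -/

section InteriorTensor

variable {G : Type*} [NormedAddCommGroup G] [InnerProductSpace ℂ G] [CompleteSpace G]
  (B : VonNeumannAlgebra G)
  {E : Type*} [NormedAddCommGroup E] [NormedSpace ℂ E] [Module Bᵐᵒᵖ E] [CStarModule Bᵐᵒᵖ E]

theorem creation_add (x y : E) : creation B (x + y) = creation B x + creation B y := by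
  ext g
  simp only [creation_apply, add_apply]
  rw [← UniformSpace.Completion.coe_add]
  congr 1
  exact TensorProduct.add_tmul x y g

theorem creation_smul (c : ℂ) (x : E) : creation B (c • x) = c • creation B x := by
  ext g
  simp only [creation_apply, smul_apply]
  rw [← UniformSpace.Completion.coe_smul]
  rfl

/-- `x ↦ L_x` as a linear map. -/
noncomputable def creationₗ : E →ₗ[ℂ] (G →L[ℂ] InteriorTensor B E) where
  toFun := creation B
  map_add' := creation_add B
  map_smul' := creation_smul B

theorem creation_sub (x y : E) : creation B (x - y) = creation B x - creation B y :=
  map_sub (creationₗ B) x y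

theorem adjoint_creation_apply (x y : E) (g : G) :
    (creation B x).adjoint (creation B y g) = (ip B x y : G →L[ℂ] G) g :=
  ext_inner_left ℂ fun v => by
    rw [ContinuousLinearMap.adjoint_inner_right, inner_creation]

theorem creation_eq_zero {x : E} : creation B x = 0 ↔ x = 0 := by
  refine ⟨fun h => (ip_self_eq_zero (A := B)).1 (Subtype.ext ?_), ?_⟩
  · ext g
    rw [← adjoint_creation_apply, h]
    simp
  · rintro rfl
    exact map_zero (creationₗ B)

theorem creation_injective : Function.Injective (creation B (E := E)) := fun x y h => by
  rw [← sub_eq_zero, ← creation_eq_zero B, creation_sub, h, sub_self]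

/-- A closed subspace of `E ⊙ G` containing all `x ⊙ g` is everything. -/
theorem eq_top_of_creation_mem {K : Submodule ℂ (InteriorTensor B E)}
    (hK : IsClosed (K : Set (InteriorTensor B E))) (h : ∀ (x : E) (g : G), creation B x g ∈ K) :
    K = ⊤ := by
  refine Submodule.eq_top_iff'.2 fun k => ?_
  induction k using UniformSpace.Completion.induction_on with
  | hp => exact hK
  | ih t =>
    change E ⊗[ℂ] G at t
    induction t with
    | zero => exact K.zero_mem
    | tmul x g => exact h x g
    | add s t hs ht =>
      exact (congrArg (· ∈ K) (UniformSpace.Completion.coe_add (α := AlgTensor B E) s t)).mpr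
        (K.add_mem hs ht)

theorem eq_zero_of_forall_inner_creation {k : InteriorTensor B E}
    (h : ∀ (x : E) (g : G), ⟪creation B x g, k⟫_ℂ = 0) : k = 0 := by
  have : (ℂ ∙ k)ᗮ = ⊤ := eq_top_of_creation_mem B (Submodule.isClosed_orthogonal _)
    fun x g => Submodule.mem_orthogonal_singleton_iff_inner_left.2 (h x g)
  have hk : k ∈ (ℂ ∙ k)ᗮ := this ▸ Submodule.mem_top
  exact inner_self_eq_zero.1 (Submodule.mem_orthogonal_singleton_iff_inner_left.1 hk)

/-- The tensor product is balanced over `B`: the difference of the two vectors is orthogonal to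
every `y ⊙ h`, and these are total in `E ⊙ G`. -/
theorem creation_op_smul (x : E) (b : B) (g : G) :
    creation B (x <• b) g = creation B x ((b : G →L[ℂ] G) g) := by
  rw [← sub_eq_zero]
  refine eq_zero_of_forall_inner_creation B fun y h => ?_
  rw [inner_sub_right, inner_creation, inner_creation, ip_op_smul_right]
  simp

/-- Self-duality of von Neumann modules: an operator `T : G → E ⊙ G` with `L_y⋆ T ∈ B` for all
`y ∈ E` is of the form `L_ζ`. -/
theorem mem_range_creation_of_adjoint_comp_mem [IsVonNeumannModule B E]
    {T : G →L[ℂ] InteriorTensor B E} (hT : ∀ y : E, (creation B y).adjoint ∘L T ∈ B) :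
    T ∈ Set.range (creation B (E := E)) := by
  rw [← IsVonNeumannModule.sot_closed (B := B) (E := E)]
  refine mem_sotClosure_of_forall_finset fun t ε hε => ?_
  -- Approximating `T` at the finitely many vectors of `t` means approximating the single vector `(T
  -- g)_g` in a finite direct sum of copies of `E ⊙ G`; `K` is the closure of the vectors `(L_y
  -- g)_g`.
  let H := PiLp 2 fun _ : t => InteriorTensor B E
  let ev : (G →L[ℂ] InteriorTensor B E) →ₗ[ℂ] H :=
    { toFun := fun S => WithLp.toLp 2 fun g => S g
      map_add' := fun _ _ => rfl
      map_smul' := fun _ _ => rfl }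
  let K : Submodule ℂ H := (LinearMap.range (ev ∘ₗ creationₗ B)).topologicalClosure
  have hKc : IsClosed (K : Set H) := Submodule.isClosed_topologicalClosure _
  have hK : ∀ y, ev (creation B y) ∈ K := fun y => Submodule.le_topologicalClosure _ ⟨y, rfl⟩
  have : CompleteSpace K := hKc.completeSpace_coe
  suffices h : ev T ∈ K by
    obtain ⟨s, ⟨y, rfl⟩, hy⟩ := Metric.mem_closure_iff.1 h ε hε
    refine ⟨creation B y, ⟨y, rfl⟩, fun g hg => ?_⟩
    rw [dist_comm, dist_eq_norm] at hy
    exact (PiLp.norm_apply_le ((ev ∘ₗ creationₗ B) y - ev T) ⟨g, hg⟩).trans_lt hy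
  -- `D y` is `L_y L_y⋆` acting diagonally. It preserves `K` because `L_y L_y⋆ L_w = L_{y⟨y,w⟩}`,
  -- and it sends `ev T` into `K` because `L_y⋆ T ∈ B`.
  let θ (y : E) : InteriorTensor B E →L[ℂ] InteriorTensor B E :=
    creation B y ∘L (creation B y).adjoint
  let D (y : E) : H →L[ℂ] H := (PiLp.continuousLinearEquiv 2 ℂ _).symm.toContinuousLinearMap ∘L
    ContinuousLinearMap.pi fun g => θ y ∘L PiLp.proj 2 _ g
  have hDev : ∀ y S, D y (ev S) = ev (θ y ∘L S) := fun y S => rfl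
  have hDK : ∀ y, ∀ k ∈ K, D y k ∈ K := by
    intro y k hk
    have hle : K ≤ K.comap (D y).toLinearMap := by
      refine Submodule.topologicalClosure_minimal _ ?_ (hKc.preimage (D y).continuous)
      rintro _ ⟨w, rfl⟩
      have : D y (ev (creation B w)) = ev (creation B (y <• ip B y w)) := by
        rw [hDev]
        congr 1
        ext g
        rw [creation_op_smul, ← adjoint_creation_apply]
        rfl
      exact (congrArg (· ∈ K) this).mpr (hK _)
    exact hle hk
  have hDT : ∀ y, D y (ev T) ∈ K := by
    intro y
    have : D y (ev T) = ev (creation B (y <• (⟨_, hT y⟩ : B))) := by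
      rw [hDev]
      congr 1
      ext g
      rw [creation_op_smul]
      rfl
    exact this ▸ hK _
  -- The component `k` of `ev T` orthogonal to `K` satisfies `D y k ∈ K`, so `0 = ⟪k, D y k⟫ = ∑
  -- ‖L_y⋆ k_g‖²` for every `y`. Every coordinate of `k` is thus orthogonal to all `y ⊙ v`.
  set k := ev T - K.starProjection (ev T) with hk
  have hkK : k ∈ Kᗮ := K.sub_starProjection_mem_orthogonal _
  have hk0 : k = 0 := by
    have h1 : ∀ y, ⟪k, D y k⟫_ℂ = 0 := fun y => by
      refine (Submodule.mem_orthogonal' _ _).1 hkK _ ?_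
      rw [hk, map_sub]
      exact K.sub_mem (hDT y) (hDK y _ (K.starProjection_apply_mem _))
    have h2 : ∀ y, ∑ g : t, ‖(creation B y).adjoint (k g)‖ ^ 2 = 0 := fun y => by
      have h3 := h1 y
      rw [PiLp.inner_apply] at h3
      have h4 : ∀ g : t, ⟪k g, D y k g⟫_ℂ = ((‖(creation B y).adjoint (k g)‖ ^ 2 : ℝ) : ℂ) := by
        intro g
        change ⟪k g, creation B y ((creation B y).adjoint (k g))⟫_ℂ = _
        rw [← ContinuousLinearMap.adjoint_inner_left, inner_self_eq_norm_sq_to_K]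
        simp
      rw [Finset.sum_congr rfl fun g _ => h4 g] at h3
      exact_mod_cast h3
    ext g
    refine eq_zero_of_forall_inner_creation B fun y v => ?_
    have h5 := (Finset.sum_eq_zero_iff_of_nonneg (fun _ _ => by positivity)).1 (h2 y) g
      (Finset.mem_univ g)
    rw [← ContinuousLinearMap.adjoint_inner_right, norm_eq_zero.1 (pow_eq_zero_iff two_ne_zero |>.1 h5),
      inner_zero_right]
  rw [sub_eq_zero.1 hk0]
  exact K.starProjection_apply_mem _

end InteriorTensor

theorem sotClosure_mono {H K : Type*} [NormedAddCommGroup H] [InnerProductSpace ℂ H]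
    [NormedAddCommGroup K] [InnerProductSpace ℂ K] {S S' : Set (H →L[ℂ] K)} (h : S ⊆ S') :
    sotClosure S ⊆ sotClosure S' := fun _ hT => by
  obtain ⟨l, hl, hS, hlim⟩ := mem_sotClosure_iff_tendsto.1 hT
  exact mem_sotClosure_iff_tendsto.2 ⟨l, hl, mem_of_superset hS h, hlim⟩

theorem exists_eq_star_mul_self {R : Type*} [CStarAlgebra R] [PartialOrder R] [StarOrderedRing R]
    {M : R} (hM : 0 ≤ M) : ∃ S, M = star S * S :=
  CStarAlgebra.nonneg_iff_eq_star_mul_self.1 hM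

/-! ### Strongly closed submodules. -/

section Embedding

variable {G : Type*} [NormedAddCommGroup G] [InnerProductSpace ℂ G] [CompleteSpace G]
  (B : VonNeumannAlgebra G)
  {E : Type*} [NormedAddCommGroup E] [NormedSpace ℂ E] [Module Bᵐᵒᵖ E] [CStarModule Bᵐᵒᵖ E]
  {F : Type*} [NormedAddCommGroup F] [NormedSpace ℂ F] [Module Bᵐᵒᵖ F] [CStarModule Bᵐᵒᵖ F]

/-- An inner product preserving map `F → E` induces an isometry `F ⊙ G → E ⊙ G`. -/
theorem exists_interiorTensor_map (j : F →ₗ[ℂ] E) (hj : ∀ x y, ip B (j x) (j y) = ip B x y) :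
    ∃ W : InteriorTensor B F →L[ℂ] InteriorTensor B E, Function.Injective W ∧
      ∀ y g, W (creation B y g) = creation B (j y) g := by
  let m : AlgTensor B F →ₗ[ℂ] AlgTensor B E := TensorProduct.map j LinearMap.id
  have hm : ∀ s t : AlgTensor B F, ⟪m s, m t⟫_ℂ = ⟪s, t⟫_ℂ := by
    intro s t
    change AlgTensor.form B E (TensorProduct.map j LinearMap.id s)
      (TensorProduct.map j LinearMap.id t) = AlgTensor.form B F s t
    change F ⊗[ℂ] G at s t
    induction s with
    | zero => simp
    | add s₁ s₂ h₁ h₂ => simp only [map_add, LinearMap.add_apply, h₁, h₂]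
    | tmul x g =>
      induction t with
      | zero => simp
      | add t₁ t₂ h₁ h₂ => simp only [map_add, h₁, h₂]
      | tmul x' g' =>
        rw [TensorProduct.map_tmul, TensorProduct.map_tmul, AlgTensor.form_tmul,
          AlgTensor.form_tmul, hj]
        rfl
  let mi : AlgTensor B F →ₗᵢ[ℂ] AlgTensor B E :=
    ⟨m, fun t => by rw [@norm_eq_sqrt_re_inner ℂ, @norm_eq_sqrt_re_inner ℂ, hm]⟩
  let f : AlgTensor B F →ₗ[ℂ] InteriorTensor B E :=
    (UniformSpace.Completion.toComplL (𝕜 := ℂ) (E := AlgTensor B E)).toLinearMap ∘ₗ m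
  let e : AlgTensor B F →ₗ[ℂ] InteriorTensor B F :=
    (UniformSpace.Completion.toComplL (𝕜 := ℂ) (E := AlgTensor B F)).toLinearMap
  have he : DenseRange e := UniformSpace.Completion.denseRange_coe
  have hfe : ∀ t, ‖f t‖ = ‖e t‖ := fun t =>
    (UniformSpace.Completion.norm_coe _).trans
      ((mi.norm_map t).trans (UniformSpace.Completion.norm_coe _).symm)
  have hW : ∀ t, f.extendOfNorm e (e t) = f t :=
    LinearMap.extendOfNorm_eq he ⟨1, fun t => by rw [hfe, one_mul]⟩
  refine ⟨f.extendOfNorm e, ?_, fun y g => hW _⟩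
  have hn : ∀ t, ‖f.extendOfNorm e t‖ = ‖t‖ := fun t =>
    he.induction (P := fun t => ‖f.extendOfNorm e t‖ = ‖t‖)
      (by rintro _ ⟨t, rfl⟩; rw [hW, hfe])
      (isClosed_eq (by fun_prop) (by fun_prop)) t
  exact (AddMonoidHomClass.isometry_of_norm _ hn).injective

/-- A strongly closed, complete subspace of a von Neumann module is a von Neumann module. -/
theorem IsVonNeumannModule.of_embedding [IsVonNeumannModule B E] [CompleteSpace F]
    (j : F →ₗ[ℂ] E) (hj : ∀ x y, ip B (j x) (j y) = ip B x y)
    (hcl : ∀ y, creation B y ∈ sotClosure (creation B '' Set.range j) → y ∈ Set.range j) :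
    IsVonNeumannModule B F where
  complete := inferInstance
  sot_closed := by
    obtain ⟨W, hWi, hW⟩ := exists_interiorTensor_map B j hj
    refine subset_antisymm (fun T hT => ?_) (subset_sotClosure _)
    -- The strong limit is moved by the isometry `W` into `E ⊙ G`, where it must be some `L_y`;
    -- injectivity of `W` brings it back. The trailing identity only matches the shape required by
    -- `sotClosure_mapsTo`.
    have hWj : ∀ y, W ∘L creation B y ∘L ContinuousLinearMap.id ℂ G = creation B (j y) :=
      fun y => ContinuousLinearMap.ext fun g => hW y g
    have h1 : W ∘L T ∘L ContinuousLinearMap.id ℂ G ∈ sotClosure (creation B '' Set.range j) := by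
      refine sotClosure_mapsTo hT W _ ?_
      rintro _ ⟨y, rfl⟩
      exact ⟨j y, ⟨y, rfl⟩, (hWj y).symm⟩
    have h2 : W ∘L T ∘L ContinuousLinearMap.id ℂ G ∈ Set.range (creation B (E := E)) := by
      rw [← IsVonNeumannModule.sot_closed (B := B) (E := E)]
      refine sotClosure_mono ?_ h1
      exact Set.image_subset_range _ _
    obtain ⟨y, hy⟩ := h2
    obtain ⟨w, rfl⟩ := hcl y (hy ▸ h1)
    refine ⟨w, ContinuousLinearMap.ext fun g => hWi ?_⟩
    rw [hW, hy]
    rfl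

end Embedding

/-! ### Consequences of a central unit vector, and its recovery from a splitting. -/

section Bimodule

variable {G : Type*} [NormedAddCommGroup G] [InnerProductSpace ℂ G] [CompleteSpace G]
  {B : VonNeumannAlgebra G}
  {E : Type*} [NormedAddCommGroup E] [NormedSpace ℂ E] [Module B E] [Module Bᵐᵒᵖ E]
  [CStarModule Bᵐᵒᵖ E] [IsVonNeumannBimodule B B E]

theorem ip_smul_right_eq (b : B) (x y : E) : ip B x (b • y) = ip B (star b • x) y := by
  rw [IsVonNeumannBimodule.ip_left_action, star_star]

/-- Moving `b` across as `b⋆` and then to the right of `z` makes `⟨z,·⟩` left linear, hence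
bilinear. -/
theorem ip_center_smul {z : E} (hz : z ∈ bimoduleCenter B E) (b : B) (y : E) :
    ip B z (b • y) = b * ip B z y := by
  rw [ip_smul_right_eq, hz, ip_op_smul_left, star_star]

theorem adjoint_creation_comp (x y : E) :
    (creation B x).adjoint ∘L creation B y ∘L ContinuousLinearMap.id ℂ G = ip B x y :=
  ContinuousLinearMap.ext fun g => adjoint_creation_apply B x y g

/-- `⟨z,y⟩` is the operator `L_z⋆ L_y`, which is strongly continuous in `L_y`. -/
theorem ip_eq_zero_of_mem_sotClosure {S : Set E} {z y : E} (hS : ∀ s ∈ S, ip B z s = 0)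
    (hy : creation B y ∈ sotClosure (creation B '' S)) : ip B z y = 0 := by
  refine Subtype.ext (ContinuousLinearMap.ext fun g => ?_)
  rw [← adjoint_creation_apply]
  refine sotClosure_induction hy (f := fun T => (creation B z).adjoint (T g)) (f' := fun _ => 0)
    (fun l h => ((creation B z).adjoint.continuous.tendsto _).comp (h g))
    (fun l h => tendsto_const_nhds) ?_
  rintro _ ⟨s, hs, rfl⟩
  change (creation B z).adjoint (creation B s g) = 0
  rw [adjoint_creation_apply, hS s hs]
  rfl

variable (B) in
/-- The completely positive map `b ↦ ⟨f, b f⟩`. -/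
noncomputable def vectorCP (f : E) : B →CP B where
  toFun b := ip B f (b • f)
  map_add' a b := by rw [add_smul, ip_add_right]
  map_smul' c b := by rw [smul_assoc, ip_smul_right, RingHom.id_apply]
  map_cstarMatrix_nonneg' k M hM := by
    -- Writing `M = S⋆S` gives `⟨f, M_ij f⟩ = ∑_l ⟨S_li f, S_lj f⟩`, a sum of Gram matrices, each
    -- positive.
    obtain ⟨S, rfl⟩ := exists_eq_star_mul_self (R := CStarMatrix (Fin k) (Fin k) B) hM
    choose R hR using fun l => exists_gram_eq (A := B) fun i => S l i • f
    have h : (star S * S).map (fun b : B => ip B f (b • f)) =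
        ∑ l, star (CStarMatrix.ofMatrix (R l)) * CStarMatrix.ofMatrix (R l) := by
      refine CStarMatrix.ext fun i j => ?_
      have h1 : ∀ T : CStarMatrix (Fin k) (Fin k) B,
          (star T * T) i j = ∑ l, star (T l i) * T l j := fun T => by
        rw [CStarMatrix.mul_apply]; rfl
      have h2 : ∀ (s : Finset (Fin k)) (f : Fin k → CStarMatrix (Fin k) (Fin k) B),
          (∑ l ∈ s, f l) i j = ∑ l ∈ s, f l i j := fun s f => by
        induction s using Finset.cons_induction with
        | empty => simp
        | cons a s ha ih => rw [Finset.sum_cons, Finset.sum_cons, CStarMatrix.add_apply, ih]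
      rw [h2, CStarMatrix.map_apply, h1, Finset.sum_smul, ip_sum_right]
      refine Finset.sum_congr rfl fun l _ => ?_
      rw [h1, mul_smul, ip_smul_right_eq, star_star, hR]
      rfl
    change 0 ≤ (star S * S).map (fun b : B => ip B f (b • f))
    rw [h]
    exact Finset.sum_nonneg fun l _ => star_mul_self_nonneg _

theorem vectorCP_apply (f : E) (b : B) : vectorCP B f b = ip B f (b • f) := rfl

theorem stronglyClosedIdeal_subset (c : B) : stronglyClosedIdeal c ⊆ B := by
  refine B.sotClosure_subset ?_
  rintro _ ⟨b, -, rfl⟩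
  exact b.2

/-- A unit vector in the center yields a summand `c⋆ b c` of `φ` with `c` strongly generating. -/
theorem exists_cp_decomposition_of_unit {φ : B →CP B} {x : E} (hx : IsMinimalGNS φ x) {z : E}
    (hz : z ∈ bimoduleCenter B E) (hz1 : ip B z z = 1) :
    ∃ (c : B) (ψ : B →CP B), stronglyClosedIdeal c = B ∧ ∀ b : B, φ b = star c * b * c + ψ b := by
  refine ⟨ip B z x, vectorCP B (x - z <• ip B z x), ?_, fun b => ?_⟩
  · refine subset_antisymm (stronglyClosedIdeal_subset _) fun T hT => ?_
    -- `L_{zT⋆}⋆ L_z = T⟨z,z⟩ = T`, while replacing the second `z` by `s ∈ span BxB` gives `T⟨z,s⟩`,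
    -- which lies in the ideal generated by `⟨z,x⟩`.
    have h1 := sotClosure_mapsTo (hx.minimal z) (creation B (z <• star (⟨T, hT⟩ : B))).adjoint
      (ContinuousLinearMap.id ℂ G) (S' := (fun b : B => (b : G →L[ℂ] G)) ''
        (TwoSidedIdeal.span {ip B z x} : Set B)) ?_
    · rw [adjoint_creation_comp, ip_op_smul_left, hz1, star_star, mul_one] at h1
      exact h1
    · rintro _ ⟨s, hs, rfl⟩
      refine ⟨_, ?_, (adjoint_creation_comp _ s).symm⟩
      rw [ip_op_smul_left]
      refine TwoSidedIdeal.mul_mem_left _ _ _ ?_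
      refine Submodule.span_induction ?_ ?_ ?_ ?_ hs
      · rintro _ ⟨a, b, rfl⟩
        rw [ip_op_smul_right, ip_center_smul hz]
        exact TwoSidedIdeal.mul_mem_right _ _ _ (TwoSidedIdeal.mul_mem_left _ _ _
          (TwoSidedIdeal.subset_span rfl))
      · rw [ip_zero_right]
        exact TwoSidedIdeal.zero_mem _
      · intro s t _ _ hs ht
        rw [ip_add_right]
        exact TwoSidedIdeal.add_mem _ hs ht
      · intro c s _ hs
        rw [ip_smul_right, ← one_mul (ip B z s), ← smul_mul_assoc]
        exact TwoSidedIdeal.mul_mem_left _ _ _ hs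
  -- With `c = ⟨z,x⟩`, both cross terms of `⟨x - zc, b(x - zc)⟩` and the final term equal `c⋆bc`, so
  -- the net contribution beside `φ(b)` is `-c⋆bc`.
  · have h1 : ip B x (b • z) = star (ip B z x) * b := by
      rw [hz b, ip_op_smul_right, star_ip]
    have h2 : ip B z (b • z) = b := by rw [ip_center_smul hz, hz1, mul_one]
    rw [vectorCP_apply, smul_sub, smul_comm b (MulOpposite.op (ip B z x)) z, ip_sub_right,
      ip_sub_left, ip_sub_left, ip_op_smul_right, ip_op_smul_left, ip_op_smul_left,
      ip_op_smul_right, h1, h2, ip_center_smul hz, hx.gns]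
    simp only [mul_assoc]
    abel

/-- The vectors orthogonal to `z`. -/
def ipOrthogonal (B : VonNeumannAlgebra G) {E : Type*} [NormedAddCommGroup E] [NormedSpace ℂ E]
    [Module Bᵐᵒᵖ E] [CStarModule Bᵐᵒᵖ E] (z : E) : Submodule ℂ E where
  carrier := {y | ip B z y = 0}
  add_mem' {a b} ha hb := by
    simp only [Set.mem_ofPred_eq] at *
    rw [ip_add_right, ha, hb, add_zero]
  zero_mem' := ip_zero_right z
  smul_mem' c y hy := by
    simp only [Set.mem_ofPred_eq] at *
    rw [ip_smul_right, hy, smul_zero]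

theorem mem_ipOrthogonal {z y : E} : y ∈ ipOrthogonal B z ↔ ip B z y = 0 := Iff.rfl

/-- The decomposition is `y = z⟨z,y⟩ + (y - z⟨z,y⟩)`. Centrality of `z` makes both summands
invariant under the left action and identifies `zB` with `B` as a bimodule. -/
theorem exists_iso_of_unit {z : E} (hz : z ∈ bimoduleCenter B E) (hz1 : ip B z z = 1) :
    ∃ (_ : Module B (ipOrthogonal B z)) (_ : Module Bᵐᵒᵖ (ipOrthogonal B z))
      (_ : CStarModule Bᵐᵒᵖ (ipOrthogonal B z)) (_ : IsVonNeumannBimodule B B (ipOrthogonal B z)),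
      Nonempty (BimoduleIso B B E C⋆ᵐᵒᵈ(Bᵐᵒᵖ, B × ipOrthogonal B z)) := by
  have hl : ∀ (b : B) (y : E), y ∈ ipOrthogonal B z → b • y ∈ ipOrthogonal B z := fun b y hy => by
    rw [mem_ipOrthogonal, ip_center_smul hz, mem_ipOrthogonal.1 hy, mul_zero]
  have hr : ∀ (b : Bᵐᵒᵖ) (y : E), y ∈ ipOrthogonal B z → b • y ∈ ipOrthogonal B z :=
    fun b y hy => (ip_op_smul_right b.unop z y).trans (by rw [mem_ipOrthogonal.1 hy, zero_mul])
  let : SMul B (ipOrthogonal B z) := ⟨fun b y => ⟨b • y.1, hl b y y.2⟩⟩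
  let : SMul Bᵐᵒᵖ (ipOrthogonal B z) := ⟨fun b y => ⟨b • y.1, hr b y y.2⟩⟩
  let iL : Module B (ipOrthogonal B z) := Function.Injective.module B
    (ipOrthogonal B z).subtype.toAddMonoidHom Subtype.val_injective fun _ _ => rfl
  let iR : Module Bᵐᵒᵖ (ipOrthogonal B z) := Function.Injective.module Bᵐᵒᵖ
    (ipOrthogonal B z).subtype.toAddMonoidHom Subtype.val_injective fun _ _ => rfl
  let iC : CStarModule Bᵐᵒᵖ (ipOrthogonal B z) :=
    { inner := fun x y => inner Bᵐᵒᵖ x.1 y.1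
      inner_add_right := CStarModule.inner_add_right
      inner_self_nonneg := CStarModule.inner_self_nonneg
      inner_self := CStarModule.inner_self.trans ZeroMemClass.coe_eq_zero
      inner_op_smul_right := CStarModule.inner_op_smul_right
      inner_smul_right_complex := CStarModule.inner_smul_right_complex
      star_inner := fun x y => CStarModule.star_inner x.1 y.1
      norm_eq_sqrt_norm_inner_self := fun x => CStarModule.norm_eq_sqrt_norm_inner_self x.1 }
  have hsub : ∀ y, creation B y ∈ sotClosure (creation B ''
      Set.range (ipOrthogonal B z).subtype) → y ∈ Set.range (ipOrthogonal B z).subtype := by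
    intro y hy
    refine ⟨⟨y, ip_eq_zero_of_mem_sotClosure ?_ hy⟩, rfl⟩
    rintro _ ⟨s, rfl⟩
    exact s.2
  have : CompleteSpace E := IsVonNeumannModule.complete B
  -- Norm convergence in `E` implies strong convergence of the operators `L_y`, since `‖L_y g‖ ≤
  -- ‖y‖‖g‖`; norm closedness then follows from strong closedness.
  have hclosed : IsClosed (ipOrthogonal B z : Set E) := by
    refine isClosed_of_closure_subset fun y hy => ?_
    have hy' : creation B y ∈ sotClosure (creation B '' Set.range (ipOrthogonal B z).subtype) := by
      obtain ⟨u, hu, hlim⟩ := mem_closure_iff_seq_limit.1 hy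
      refine mem_sotClosure_iff_tendsto.2
        ⟨atTop.map fun n => creation B (u n), inferInstance, ?_, fun g => ?_⟩
      · exact mem_map.2 (Eventually.of_forall fun n => ⟨u n, ⟨⟨u n, hu n⟩, rfl⟩, rfl⟩)
      · refine tendsto_map'_iff.2 (tendsto_iff_norm_sub_tendsto_zero.2 ?_)
        refine squeeze_zero (fun _ => norm_nonneg _) (fun n => ?_)
          (g := fun n => ‖u n - y‖ * ‖g‖) ?_
        · have := AlgTensor.norm_tmul_le B E (u n - y) g
          rw [← UniformSpace.Completion.norm_coe, ← creation_apply, creation_sub] at this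
          exact this
        · simpa using (tendsto_iff_norm_sub_tendsto_zero.1 hlim).mul_const ‖g‖
    obtain ⟨w, hw⟩ := hsub y hy'
    exact hw ▸ w.2
  have : CompleteSpace (ipOrthogonal B z) := hclosed.completeSpace_coe
  have hvN : IsVonNeumannModule B (ipOrthogonal B z) :=
    IsVonNeumannModule.of_embedding B (ipOrthogonal B z).subtype (fun _ _ => rfl) hsub
  have hbi : IsVonNeumannBimodule B B (ipOrthogonal B z) :=
    { hvN with
      smul_assoc := fun c b y => Subtype.ext (smul_assoc c b y.1)
      smul_comm := fun a b y => Subtype.ext (smul_comm a b y.1)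
      ip_left_action := fun a x y => IsVonNeumannBimodule.ip_left_action a x.1 y.1 }
  refine ⟨iL, iR, iC, hbi, ⟨?_⟩⟩
  have hproj : ∀ y : E, y - z <• ip B z y ∈ ipOrthogonal B z := fun y => by
    rw [mem_ipOrthogonal, ip_sub_right, ip_op_smul_right, hz1, one_mul, sub_self]
  have hip : ∀ (b : B) (f : ipOrthogonal B z), ip B z (z <• b + f.1) = b := fun b f => by
    rw [ip_add_right, ip_op_smul_right, hz1, one_mul, mem_ipOrthogonal.1 f.2, add_zero]
  refine
    { toFun := fun y => (WithCStarModule.equiv Bᵐᵒᵖ (B × ipOrthogonal B z)).symm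
        (ip B z y, ⟨y - z <• ip B z y, hproj y⟩)
      invFun := fun p => z <• p.1 + p.2.1
      map_add' := fun x y => ?_
      map_smul' := fun c x => ?_
      left_inv := fun x => ?_
      right_inv := fun p => ?_
      map_left := fun b x => ?_
      map_right := fun b x => ?_
      map_ip := fun x y => ?_ }
  · refine Prod.ext (ip_add_right _ _ _) (Subtype.ext ?_)
    change x + y - z <• ip B z (x + y) = (x - z <• ip B z x) + (y - z <• ip B z y)
    rw [ip_add_right, MulOpposite.op_add, add_smul]
    abel
  · refine Prod.ext (ip_smul_right _ _ _) (Subtype.ext ?_)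
    change c • x - z <• ip B z (c • x) = c • (x - z <• ip B z x)
    rw [ip_smul_right, smul_sub, smul_op_smul]
  · exact add_sub_cancel _ _
  · refine Prod.ext (hip _ _) (Subtype.ext ?_)
    change (z <• p.1 + p.2.1) - z <• ip B z (z <• p.1 + p.2.1) = p.2.1
    rw [hip, add_sub_cancel_left]
  · refine Prod.ext (ip_center_smul hz _ _) (Subtype.ext ?_)
    change b • x - z <• ip B z (b • x) = b • (x - z <• ip B z x)
    rw [ip_center_smul hz, MulOpposite.op_mul, mul_smul, ← hz b, smul_sub,
      smul_comm b (MulOpposite.op (ip B z x)) z]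
  · refine Prod.ext (ip_op_smul_right _ _ _) (Subtype.ext ?_)
    change x <• b - z <• ip B z (x <• b) = (x - z <• ip B z x) <• b
    rw [ip_op_smul_right, MulOpposite.op_mul, mul_smul, smul_sub]
  · change star (ip B z x) * ip B z y + ip B (x - z <• ip B z x) (y - z <• ip B z y) = ip B x y
    rw [ip_sub_left, ip_op_smul_left, mem_ipOrthogonal.1 (hproj y), mul_zero, sub_zero,
      ip_sub_right, ip_op_smul_right, star_ip, add_sub_cancel]

/-- The witness is the preimage of `(1, 0)`, which is central and of unit length in the direct sum.
-/
theorem exists_unit_of_iso {F : Type*} [NormedAddCommGroup F] [NormedSpace ℂ F] [Module B F]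
    [Module Bᵐᵒᵖ F] [CStarModule Bᵐᵒᵖ F]
    (e : BimoduleIso B B E C⋆ᵐᵒᵈ(Bᵐᵒᵖ, B × F)) : ∃ z ∈ bimoduleCenter B E, ip B z z = 1 := by
  set w : C⋆ᵐᵒᵈ(Bᵐᵒᵖ, B × F) := (WithCStarModule.equiv Bᵐᵒᵖ (B × F)).symm (1, 0) with hw
  have hes : e.toFun (e.toLinearEquiv.symm w) = w := e.toLinearEquiv.apply_symm_apply w
  refine ⟨e.toLinearEquiv.symm w, fun b => e.toLinearEquiv.injective ?_, ?_⟩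
  · refine (e.map_left b _).trans (Eq.trans ?_ (e.map_right b _).symm)
    rw [hes]
    refine Prod.ext ?_ ?_
    · change b * 1 = 1 * b
      rw [mul_one, one_mul]
    · change b • (0 : F) = (0 : F) <• b
      rw [smul_zero, smul_zero]
  · rw [← e.map_ip, hes]
    change star (1 : B) * 1 + ip B (0 : F) 0 = 1
    rw [ip_zero_right, star_one, mul_one, add_zero]

end Bimodule

/-! ### Complete positivity tested on vectors. -/

section CompletelyPositive

variable {G : Type*} [NormedAddCommGroup G] [InnerProductSpace ℂ G] [CompleteSpace G]
  {B : VonNeumannAlgebra G}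

theorem VonNeumannAlgebra.coe_mul (a b : B) : ((a * b : B) : G →L[ℂ] G) = a * b := rfl

/-- The matrix `(a_i⋆ a_j)` is the Gram matrix of the `a_i` in `A₁` as a module over itself, hence
positive; its image under `ψ` is positive and so has the form `S⋆S`. -/
theorem CompletelyPositiveMap.exists_gram_eq {A₁ A₂ : Type*} [CStarAlgebra A₁] [PartialOrder A₁]
    [StarOrderedRing A₁] [CStarAlgebra A₂] [PartialOrder A₂] [StarOrderedRing A₂]
    (ψ : A₁ →CP A₂) {n : Type*} [Fintype n] (a : n → A₁) :
    ∃ S : n → n → A₂, ∀ i j, ψ (star (a i) * a j) = ∑ k, star (S k i) * S k j := by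
  classical
  obtain ⟨R, hR⟩ := _root_.exists_gram_eq (A := A₁) a
  let M : CStarMatrix n n A₁ := CStarMatrix.ofMatrix fun i j => star (a i) * a j
  let R' : CStarMatrix n n A₁ := CStarMatrix.ofMatrix R
  have hMR : M = star R' * R' := by
    refine CStarMatrix.ext fun i j => ?_
    rw [CStarMatrix.mul_apply]
    exact hR i j
  have hM : 0 ≤ M := hMR ▸ star_mul_self_nonneg R'
  obtain ⟨S, hS⟩ := exists_eq_star_mul_self (R := CStarMatrix n n A₂)
    (ψ.map_cstarMatrix_nonneg M hM)
  refine ⟨fun i j => S i j, fun i j => ?_⟩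
  have h1 := congrFun (congrFun hS i) j
  rw [CStarMatrix.mul_apply] at h1
  exact h1

/-- Complete positivity, expressed by vectors of the underlying Hilbert space. -/
theorem CompletelyPositiveMap.re_sum_inner_nonneg (ψ : B →CP B) {n : Type*} [Fintype n]
    (a : n → B) (g : n → G) :
    0 ≤ (∑ i, ∑ j, ⟪g i, (ψ (star (a i) * a j) : G →L[ℂ] G) (g j)⟫_ℂ).re := by
  obtain ⟨S, hψ⟩ := ψ.exists_gram_eq a
  have hk : ∀ i j, ⟪g i, (ψ (star (a i) * a j) : G →L[ℂ] G) (g j)⟫_ℂ =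
      ∑ k, ⟪(S k i : G →L[ℂ] G) (g i), (S k j : G →L[ℂ] G) (g j)⟫_ℂ := fun i j => by
    rw [hψ, AddSubmonoidClass.coe_finsetSum, sum_apply, inner_sum]
    refine Finset.sum_congr rfl fun k _ => ?_
    rw [VonNeumannAlgebra.coe_mul, StarMemClass.coe_star, AlgTensor.inner_star_mul]
  have h : ∑ i, ∑ j, ⟪g i, (ψ (star (a i) * a j) : G →L[ℂ] G) (g j)⟫_ℂ =
      ∑ k, ⟪∑ i, (S k i : G →L[ℂ] G) (g i), ∑ j, (S k j : G →L[ℂ] G) (g j)⟫_ℂ := by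
    simp only [hk]
    rw [Finset.sum_congr rfl fun i _ => Finset.sum_comm, Finset.sum_comm]
    refine Finset.sum_congr rfl fun k _ => ?_
    rw [sum_inner]
    exact Finset.sum_congr rfl fun i _ => (inner_sum _ _ _).symm
  rw [h, Complex.re_sum]
  exact Finset.sum_nonneg fun k _ => inner_self_nonneg (𝕜 := ℂ)

end CompletelyPositive

/-! ### From a dominated elementary map to a central unit vector. -/

section MinimalGNS

variable {G : Type*} [NormedAddCommGroup G] [InnerProductSpace ℂ G] [CompleteSpace G]
  {B : VonNeumannAlgebra G}
  {E : Type*} [NormedAddCommGroup E] [NormedSpace ℂ E] [Module B E] [Module Bᵐᵒᵖ E]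
  [CStarModule Bᵐᵒᵖ E] [IsVonNeumannBimodule B B E] {φ : B →CP B} {x : E}

/-- Right linearity extends the equality to `span BxB`, and strong density then makes `w - w'`
orthogonal to itself. -/
theorem IsMinimalGNS.ext (hx : IsMinimalGNS φ x) {w w' : E}
    (h : ∀ a : B, ip B (a • x) w = ip B (a • x) w') : w = w' := by
  rw [← sub_eq_zero, ← ip_self_eq_zero (A := B)]
  refine ip_eq_zero_of_mem_sotClosure (fun s hs => ?_) (hx.minimal _)
  rw [← star_ip, star_eq_zero]
  refine Submodule.span_induction ?_ ?_ ?_ ?_ hs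
  · rintro _ ⟨a, b, rfl⟩
    rw [ip_op_smul_left, ip_sub_right, h, sub_self, mul_zero]
  · rw [← star_ip, ip_zero_right, star_zero]
  · intro s t _ _ hs ht
    rw [ip_add_left, hs, ht, add_zero]
  · intro c s _ hs
    rw [ip_smul_left, hs, smul_zero]

/-- If `φ = c⋆ · c + ψ` with `ψ` completely positive, then `a x ⊙ g ↦ a c g` is a contraction. -/
theorem IsMinimalGNS.exists_contraction (hx : IsMinimalGNS φ x) {c : B} {ψ : B →CP B}
    (hφ : ∀ b, φ b = star c * b * c + ψ b) :
    ∃ V : InteriorTensor B E →L[ℂ] G,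
      ∀ a : B, V ∘L creation B (a • x) = ((a * c : B) : G →L[ℂ] G) := by
  let e : (B →₀ G) →ₗ[ℂ] InteriorTensor B E :=
    Finsupp.lsum ℂ fun a => (creation B (a • x)).toLinearMap
  let f : (B →₀ G) →ₗ[ℂ] G := Finsupp.lsum ℂ fun a => ((a * c : B) : G →L[ℂ] G).toLinearMap
  have hes : ∀ a g, e (Finsupp.single a g) = creation B (a • x) g := fun a g =>
    Finsupp.lsum_single ℂ _ a g
  have hfs : ∀ a g, f (Finsupp.single a g) = ((a * c : B) : G →L[ℂ] G) g := fun a g =>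
    Finsupp.lsum_single ℂ _ a g
  -- Since `axb ⊙ g = ax ⊙ bg`, the vectors `ax ⊙ g` already span all `s ⊙ g` with `s ∈ span BxB`; a
  -- strong limit evaluated at `g` is a norm limit.
  have hdense : DenseRange e := by
    have hspan : ∀ s ∈ Submodule.span ℂ {z : E | ∃ (a : B) (b : B), z = (a • x) <• b}, ∀ g,
        creation B s g ∈ LinearMap.range e := by
      intro s hs
      refine Submodule.span_induction ?_ ?_ ?_ ?_ hs
      · rintro _ ⟨a, b, rfl⟩ g
        rw [creation_op_smul, ← hes]
        exact ⟨_, rfl⟩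
      · intro g
        rw [(creation_eq_zero B).2 rfl]
        exact Submodule.zero_mem _
      · intro s t _ _ hs ht g
        rw [creation_add]
        exact Submodule.add_mem _ (hs g) (ht g)
      · intro c s _ hs g
        rw [creation_smul]
        exact Submodule.smul_mem _ c (hs g)
    have htop := eq_top_of_creation_mem B (E := E)
      (LinearMap.range e).isClosed_topologicalClosure fun y g => by
        obtain ⟨l, hl, hS, hlim⟩ := mem_sotClosure_iff_tendsto.1 (hx.minimal y)
        refine mem_closure_of_tendsto (hlim g) ?_
        filter_upwards [hS]
        rintro _ ⟨s, hs, rfl⟩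
        exact hspan s hs g
    have := (LinearMap.range e).dense_iff_topologicalClosure_eq_top.2 htop
    rwa [LinearMap.coe_range] at this
  have hnorm : ∀ t, ‖f t‖ ≤ 1 * ‖e t‖ := by
    intro t
    rw [one_mul]
    refine (sq_le_sq₀ (norm_nonneg _) (norm_nonneg _)).1 ?_
    rw [← inner_self_eq_norm_sq (𝕜 := ℂ), ← inner_self_eq_norm_sq (𝕜 := ℂ)]
    have het : e t = ∑ i : t.support, creation B (i.1 • x) (t i.1) :=
      (Finset.sum_coe_sort t.support fun a => creation B (a • x) (t a)).symm
    have hft : f t = ∑ i : t.support, ((i.1 * c : B) : G →L[ℂ] G) (t i.1) :=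
      (Finset.sum_coe_sort t.support fun a => ((a * c : B) : G →L[ℂ] G) (t a)).symm
    have hij : ∀ i j : t.support, ⟪creation B (i.1 • x) (t i.1), creation B (j.1 • x) (t j.1)⟫_ℂ =
        ⟪((i.1 * c : B) : G →L[ℂ] G) (t i.1), ((j.1 * c : B) : G →L[ℂ] G) (t j.1)⟫_ℂ +
          ⟪t i.1, (ψ (star i.1 * j.1) : G →L[ℂ] G) (t j.1)⟫_ℂ := by
      intro i j
      have h1 : ip B (i.1 • x) (j.1 • x) = star (i.1 * c) * (j.1 * c) + ψ (star i.1 * j.1) := by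
        rw [IsVonNeumannBimodule.ip_left_action, ← mul_smul, ← hx.gns, hφ, star_mul]
        simp only [mul_assoc]
      rw [inner_creation, h1, AddMemClass.coe_add, add_apply, inner_add_right,
        VonNeumannAlgebra.coe_mul (star (i.1 * c)), StarMemClass.coe_star, AlgTensor.inner_star_mul]
    -- By `⟨ax, a'x⟩ = (ac)⋆(a'c) + ψ(a⋆a')`, the gap `‖e t‖² - ‖f t‖²` is the quadratic form of
    -- `ψ`, nonnegative by complete positivity.
    have key : ⟪e t, e t⟫_ℂ = ⟪f t, f t⟫_ℂ +
        ∑ i : t.support, ∑ j : t.support, ⟪t i.1, (ψ (star i.1 * j.1) : G →L[ℂ] G) (t j.1)⟫_ℂ := by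
      rw [het, hft]
      simp only [sum_inner, inner_sum, hij, Finset.sum_add_distrib]
      congr 1
      exact Finset.sum_comm
    rw [key, map_add]
    exact le_add_of_nonneg_right
      (ψ.re_sum_inner_nonneg (fun i : t.support => i.1) fun i : t.support => t i.1)
  refine ⟨f.extendOfNorm e, fun a => ContinuousLinearMap.ext fun g => ?_⟩
  rw [ContinuousLinearMap.comp_apply, ← hes, LinearMap.extendOfNorm_eq hdense ⟨1, hnorm⟩, hfs]

/-- The dominated elementary map `b ↦ c⋆ b c` is implemented by a central vector. -/
theorem IsMinimalGNS.exists_center_of_decomposition (hx : IsMinimalGNS φ x) {c : B} {ψ : B →CP B}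
    (hφ : ∀ b, φ b = star c * b * c + ψ b) :
    ∃ ζ ∈ bimoduleCenter B E, ∀ a : B, ip B (a • x) ζ = star (a * c) := by
  obtain ⟨V, hV⟩ := hx.exists_contraction hφ
  have hVB : ∀ y, V ∘L creation B y ∈ B := by
    intro y
    have h1 := sotClosure_mapsTo (hx.minimal y) V (ContinuousLinearMap.id ℂ G)
      (S' := (B : Set (G →L[ℂ] G))) ?_
    · exact B.sotClosure_subset subset_rfl h1
    · rintro _ ⟨s, hs, rfl⟩
      change V ∘L creation B s ∈ B
      refine Submodule.span_induction ?_ ?_ ?_ ?_ hs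
      · rintro _ ⟨a, b, rfl⟩
        have : V ∘L creation B ((a • x) <• b) = ((a * c * b : B) : G →L[ℂ] G) := by
          rw [VonNeumannAlgebra.coe_mul (a * c), ← hV]
          ext g
          exact congrArg V (creation_op_smul B (a • x) b g)
        rw [this]
        exact SetLike.coe_mem _
      · rw [(creation_eq_zero B).2 rfl, ContinuousLinearMap.comp_zero]
        exact zero_mem B
      · intro s t _ _ hs ht
        rw [creation_add, ContinuousLinearMap.comp_add]
        exact add_mem hs ht
      · intro c s _ hs
        rw [creation_smul, ContinuousLinearMap.comp_smul]
        exact SMulMemClass.smul_mem c hs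
  have hadj : ∀ y, (creation B y).adjoint ∘L V.adjoint = star (V ∘L creation B y) := fun y => by
    rw [ContinuousLinearMap.star_eq_adjoint, ContinuousLinearMap.adjoint_comp]
  obtain ⟨ζ, hζ⟩ := mem_range_creation_of_adjoint_comp_mem B (E := E) (T := V.adjoint)
    fun y => by rw [hadj]; exact star_mem (hVB y)
  have hip : ∀ a : B, ip B (a • x) ζ = star (a * c) := fun a => by
    refine Subtype.ext (ContinuousLinearMap.ext fun g => ?_)
    rw [← adjoint_creation_apply, hζ, StarMemClass.coe_star, ← hV, ← hadj]
    rfl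
  -- Tested against `ax`: `⟨ax, bζ⟩ = ⟨b⋆ax, ζ⟩ = (b⋆ac)⋆ = (ac)⋆b = ⟨ax, ζb⟩`.
  refine ⟨ζ, fun b => hx.ext fun a => ?_, hip⟩
  rw [ip_smul_right_eq, ip_op_smul_right, ← mul_smul, hip, hip, ← star_star b, ← star_mul,
    star_star, mul_assoc]

theorem inner_eq_zero_of_mem_span {c : B} {h : G}
    (hc : ∀ (a : B) (g : G), ⟪((a * c : B) : G →L[ℂ] G) g, h⟫_ℂ = 0) {s : B}
    (hs : s ∈ TwoSidedIdeal.span {c}) (g : G) : ⟪(s : G →L[ℂ] G) g, h⟫_ℂ = 0 := by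
  -- Quantifying over the left factor `a` and the vector `g` is what makes this set a two-sided
  -- ideal: a left factor is absorbed in `a`, a right one in `g`.
  let I : TwoSidedIdeal B := TwoSidedIdeal.mk'
    {s | ∀ (a : B) (g : G), ⟪((a * s : B) : G →L[ℂ] G) g, h⟫_ℂ = 0}
    (fun a g => by simp)
    (fun {s t} hs ht a g => by
      rw [mul_add, AddMemClass.coe_add, add_apply, inner_add_left, hs, ht, add_zero])
    (fun {s} hs a g => by
      rw [mul_neg, NegMemClass.coe_neg, neg_apply, inner_neg_left, hs, neg_zero])
    (fun {s t} ht a g => by rw [← mul_assoc]; exact ht _ g)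
    (fun {s t} hs a g => by
      rw [← mul_assoc, VonNeumannAlgebra.coe_mul (a * s)]
      exact hs a _)
  have h1 : s ∈ I := TwoSidedIdeal.mem_span_iff.1 hs I (by
    rintro _ rfl
    exact (TwoSidedIdeal.mem_mk' _ _ _ _ _ _ _).2 hc)
  have h2 := (TwoSidedIdeal.mem_mk' _ _ _ _ _ _ _).1 h1 1 g
  rwa [one_mul] at h2

/-- Polar decomposition of a central vector `ζ` for which `L_ζ` is injective. -/
theorem exists_unit_of_center_of_injective {ζ : E} (hζ : ζ ∈ bimoduleCenter B E)
    (hinj : ∀ g, creation B ζ g = 0 → g = 0) : ∃ z ∈ bimoduleCenter B E, ip B z z = 1 := by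
  set d := ip B ζ ζ with hd
  have hd0 : 0 ≤ d := ip_self_nonneg ζ
  -- `⟨ζ, bζ⟩` equals both `bd` and `db`, so `d` and its square root `r` are central in `B`.
  have hdc : ∀ b, Commute d b := fun b => by
    have h1 := ip_center_smul hζ b ζ
    rw [hζ, ip_op_smul_right] at h1
    exact h1
  set r := CFC.sqrt d with hr
  have hrr : r * r = d := CFC.sqrt_mul_sqrt_self d hd0
  have hrs : star r = r := (IsSelfAdjoint.of_nonneg (CFC.sqrt_nonneg d)).star_eq
  have hrc : ∀ b, Commute r b := fun b => (hdc b).cfcₙ_nnreal NNReal.sqrt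
  have hrd : ∀ g, ((r : G →L[ℂ] G) ((r : G →L[ℂ] G) g)) = (d : G →L[ℂ] G) g := fun g => by
    rw [← hrr]; rfl
  have hrsa : (r : G →L[ℂ] G).adjoint = r := by
    rw [← ContinuousLinearMap.star_eq_adjoint, ← StarMemClass.coe_star, hrs]
  have hnorm : ∀ g, ‖creation B ζ g‖ = ‖(r : G →L[ℂ] G) g‖ := fun g => by
    rw [@norm_eq_sqrt_re_inner ℂ, @norm_eq_sqrt_re_inner ℂ, inner_creation, ← hd, ← hrd,
      ← ContinuousLinearMap.adjoint_inner_left, hrsa]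
  have hrinj : ∀ g, (r : G →L[ℂ] G) g = 0 → g = 0 := fun g hg =>
    hinj g (norm_eq_zero.1 (by rw [hnorm, hg, norm_zero]))
  -- A self-adjoint injective operator has dense range.
  have hdense : DenseRange (r : G →L[ℂ] G).toLinearMap := by
    have h1 : (LinearMap.range (r : G →L[ℂ] G).toLinearMap).topologicalClosure = ⊤ := by
      rw [Submodule.topologicalClosure_eq_top_iff, Submodule.eq_bot_iff]
      intro h hh
      refine hrinj h (ext_inner_left ℂ fun g => ?_)
      rw [← ContinuousLinearMap.adjoint_inner_left, hrsa, inner_zero_right]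
      exact (Submodule.mem_orthogonal _ _).1 hh _ ⟨g, rfl⟩
    have := (LinearMap.range (r : G →L[ℂ] G).toLinearMap).dense_iff_topologicalClosure_eq_top.2 h1
    rwa [LinearMap.coe_range] at this
  -- The polar part of `L_ζ`, determined by `U r = L_ζ` on the dense range of `r`.
  let U : G →L[ℂ] InteriorTensor B E :=
    (creation B ζ).toLinearMap.extendOfNorm (r : G →L[ℂ] G).toLinearMap
  have hU : ∀ g, U ((r : G →L[ℂ] G) g) = creation B ζ g :=
    LinearMap.extendOfNorm_eq hdense ⟨1, fun g => by rw [one_mul]; exact (hnorm g).le⟩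
  -- `L_y⋆ U r = ⟨y,ζ⟩ ∈ B`, and `S` in the commutant commutes with `r` and with `⟨y,ζ⟩`; hence
  -- `L_y⋆ U` commutes with `S` on the range of `r`, and everywhere by density.
  obtain ⟨z, hz⟩ := mem_range_creation_of_adjoint_comp_mem B (E := E) (T := U) fun y => by
    refine B.mem_iff_forall_commutant.2 fun S hS => ?_
    refine hdense.induction (P := fun g => S (((creation B y).adjoint ∘L U) g) =
      ((creation B y).adjoint ∘L U) (S g)) ?_ (isClosed_eq (by fun_prop) (by fun_prop))
    rintro _ ⟨g, rfl⟩
    change S ((creation B y).adjoint (U ((r : G →L[ℂ] G) g))) =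
      (creation B y).adjoint (U (S ((r : G →L[ℂ] G) g)))
    rw [hU, adjoint_creation_apply, B.commutant_apply_comm hS r.2, hU, adjoint_creation_apply,
      B.commutant_apply_comm hS (ip B y ζ).2]
  have hzr : z <• r = ζ := creation_injective B (ContinuousLinearMap.ext fun g => by
    rw [creation_op_smul, hz, hU])
  have hcancel : ∀ {w : E}, w <• r = 0 → w = 0 := fun {w} hw => by
    refine (creation_eq_zero B).1 (ContinuousLinearMap.ext fun g => ?_)
    refine hdense.induction (P := fun g => creation B w g = (0 : G →L[ℂ] InteriorTensor B E) g) ?_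
      (isClosed_eq (by fun_prop) (by fun_prop)) g
    rintro _ ⟨g, rfl⟩
    change creation B w ((r : G →L[ℂ] G) g) = 0
    rw [← creation_op_smul, hw, (creation_eq_zero B).2 rfl]
    rfl
  have hcancelB : ∀ {b : B}, b * r = 0 → b = 0 := fun {b} hb => by
    refine Subtype.ext (ContinuousLinearMap.ext fun g => ?_)
    refine hdense.induction (P := fun g => (b : G →L[ℂ] G) g = (0 : G →L[ℂ] G) g) ?_
      (isClosed_eq (by fun_prop) (by fun_prop)) g
    rintro _ ⟨g, rfl⟩
    change ((b * r : B) : G →L[ℂ] G) g = 0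
    rw [hb]
    rfl
  -- Both properties are checked after right multiplication by `r`, which is cancellable: `zr = ζ`
  -- is central, and `⟨z,z⟩r² = r⟨z,z⟩r = ⟨ζ,ζ⟩ = r²`.
  refine ⟨z, fun b => ?_, ?_⟩
  · rw [← sub_eq_zero]
    refine hcancel ?_
    have h1 : (b • z) <• r = ζ <• b := by
      rw [← smul_comm b (MulOpposite.op r) z, hzr, hζ b]
    have h2 : (z <• b) <• r = ζ <• b := by
      rw [← hzr, ← mul_smul, ← mul_smul, ← MulOpposite.op_mul, ← MulOpposite.op_mul, hrc b]
    rw [smul_sub, h1, h2, sub_self]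
  · rw [← sub_eq_zero]
    refine hcancelB (hcancelB ?_)
    have h1 : ip B z z * r * r = d := by
      rw [← (hrc (ip B z z)).eq, hd, ← hzr, ip_op_smul_left, ip_op_smul_right, hrs, mul_assoc]
    rw [sub_mul, sub_mul, h1, one_mul, hrr, sub_self]

/-- Density of the ideal is used only for injectivity of `L_ζ`: `L_ζ h = 0` gives `⟪acg, h⟫ = ⟪ax ⊙
g, ζ ⊙ h⟫ = 0`, so `h` is orthogonal to `sh` for `s` in the ideal, and in the strong limit `s → 1`
to itself. -/
theorem IsMinimalGNS.exists_unit_of_decomposition (hx : IsMinimalGNS φ x) {c : B} {ψ : B →CP B}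
    (hc : stronglyClosedIdeal c = B) (hφ : ∀ b, φ b = star c * b * c + ψ b) :
    ∃ z ∈ bimoduleCenter B E, ip B z z = 1 := by
  obtain ⟨ζ, hζ, hip⟩ := hx.exists_center_of_decomposition hφ
  refine exists_unit_of_center_of_injective hζ fun h hh => ?_
  have h0 : ∀ (a : B) (g : G), ⟪((a * c : B) : G →L[ℂ] G) g, h⟫_ℂ = 0 := fun a g => by
    have h1 := inner_creation B (a • x) ζ g h
    rw [hh, inner_zero_right, hip, StarMemClass.coe_star, ContinuousLinearMap.star_eq_adjoint,
      ContinuousLinearMap.adjoint_inner_right] at h1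
    exact h1.symm
  have h1 : (1 : G →L[ℂ] G) ∈ stronglyClosedIdeal c := hc ▸ one_mem B
  have h2 : ⟪(1 : G →L[ℂ] G) h, h⟫_ℂ = 0 := by
    refine sotClosure_induction h1 (f := fun S => ⟪S h, h⟫_ℂ) (f' := fun _ => 0)
      (fun l hl => (hl h).inner tendsto_const_nhds) (fun l _ => tendsto_const_nhds) ?_
    rintro _ ⟨s, hs, rfl⟩
    exact inner_eq_zero_of_mem_span h0 hs h
  exact inner_self_eq_zero.1 h2

end MinimalGNS

theorem proposition4p1 {G : Type u} [NormedAddCommGroup G] [InnerProductSpace ℂ G] [CompleteSpace G]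
    (B : VonNeumannAlgebra G) (φ : B →CP B)
    {E : Type v} [NormedAddCommGroup E] [NormedSpace ℂ E] [Module B E] [Module Bᵐᵒᵖ E]
    [CStarModule Bᵐᵒᵖ E] [IsVonNeumannBimodule B B E]
    (x : E) (hx : IsMinimalGNS φ x) :
    List.TFAE [
      ∃ z ∈ bimoduleCenter B E, ip B z z = 1,
      ∃ (F : Type v) (_ : NormedAddCommGroup F) (_ : NormedSpace ℂ F) (_ : Module B F)
        (_ : Module Bᵐᵒᵖ F) (_ : CStarModule Bᵐᵒᵖ F) (_ : IsVonNeumannBimodule B B F),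
        Nonempty (BimoduleIso B B E C⋆ᵐᵒᵈ(Bᵐᵒᵖ, B × F)),
      ∃ (c : B) (ψ : B →CP B), stronglyClosedIdeal c = B ∧ ∀ b : B, φ b = star c * b * c + ψ b] := by
  tfae_have 1 → 2 := fun ⟨z, hz, hz1⟩ => by
    obtain ⟨iL, iR, iC, hbi, e⟩ := exists_iso_of_unit hz hz1
    exact ⟨ipOrthogonal B z, inferInstance, inferInstance, iL, iR, iC, hbi, e⟩
  tfae_have 2 → 1 := fun ⟨F, _, _, _, _, _, _, ⟨e⟩⟩ => exists_unit_of_iso e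
  tfae_have 1 → 3 := fun ⟨z, hz, hz1⟩ => exists_cp_decomposition_of_unit hx hz hz1
  tfae_have 3 → 1 := fun ⟨c, ψ, hc, hφ⟩ => hx.exists_unit_of_decomposition hc hφ
  tfae_finish
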